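/- **Theorem.** Call points $p_1,\dots,p_n\in\mathbb{R}^2$ *separated* if $d(p_i,p_j)\ge 1$ for all $i\ne j$, where $d$ is the Euclidean distance. For $k\ge 2$, $\delta\in(0,1)$ and $s>0$ call reals $t_1,\dots,t_k$ *$(\delta,s)$-admissible* if $1\le t_1<\dots<t_k$ and $$t_{\ell(3)}\notin\bigl[(1-\delta)(t_{\ell(1)}+t_{\ell(2)}),\ t_{\ell(1)}+t_{\ell(2)}+s\bigr]\qquad\text{for all }1\le\ell(1)\le\ell(2)<\ell(3)\le k .$$ 1. For all integers $k\ge2$ and all $\delta\in(0,1)$ there are constants $n_{k,\delta},C_{k,\delta}>0$ such that for every $n\ge n_{k,\delta}$, every $(\delta,2)$-admissible $t_1,\dots,t_k$ and all separated $p_1,\dots,p_n\in\mathbb{R}^2$, the number of pairs $\{p_i,p_j\}$ ($i\neq j$) with $d(p_i,p_j)\in\bigcup_{\ell=1}^k[t_\ell,t_\ell+1]$ is at most $n^2/4+C_{k,\delta}n$. 2. For all integers $k\ge2$, all $\delta\in(0,1)$ and all $\alpha>0$ there are constants $n_{k,\delta,\alpha},C_{k,\delta,\alpha}>0$ such that for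 every $n\ge n_{k,\delta,\alpha}$, every $(\delta,2\alpha)$-admissible $t_1,\dots,t_k$ and all separated $p_1,\dots,p_n\in\mathbb{R}^2$, the number of pairs $\{p_i,p_j\}$ ($i\neq j$) with $d(p_i,p_j)\in\bigcup_{\ell=1}^k[t_\ell,t_\ell+\alpha]$ is at most $n^2/4+C_{k,\delta,\alpha}n$. 3. These bounds are essentially sharp, even for intervals of length $\varepsilon$. There is an absolute constant $c>0$, and for every integer $k\ge2$ there are $\delta_k\in(0,1)$ and $C_k>0$, such that the following holds for all $\delta\in(0,\delta_k]$, all $\varepsilon>0$ and all integers $n\ge0$. (a) For every real $T\ge\max\{3^{k-1},\,cn^2/\varepsilon\}$ there are $(\delta,2)$-admissible $t_1,\dots,t_k$ with $t_k=T$ and separated $p_1,\dots,p_n\in\mathbb{R}^2$ such that at least $n^2/4+(k-1)n-C_k$ pairs $\{p_i,p_j\}$ ($i\neq j$) satisfy $d(p_i,p_j)\in\bigcup_{\ell=1}^k[t_\ell,t_\ell+\varepsilon]$. (b) For every $\alpha>0$ there is $T_0$ such that for every real $T\ge T_0$ there are $(\delta,2\alpha)$-admissible $t_1,\dots,t_k$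 with $t_k=T$ and separated $p_1,\dots,p_n\in\mathbb{R}^2$ with the same lower bound on the number of pairs $\{p_i,p_j\}$ ($i\neq j$) with $d(p_i,p_j)\in\bigcup_{\ell=1}^k[t_\ell,t_\ell+\varepsilon]$. -/

import Mathlib

/-- The points `p 0, …, p (n-1)` of the Euclidean plane are separated: any two of them have
distance at least `1` (in particular they are distinct). -/
def IsSeparated1 {n : ℕ} (p : Fin n → EuclideanSpace ℝ (Fin 2)) : Prop :=
  ∀ i j : Fin n, i ≠ j → 1 ≤ dist (p i) (p j)

/-- `1 ≤ t_1 < … < t_k`, and for all `a ≤ b < c` the number `t_c` lies outside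
`[(1 - δ) (t_a + t_b), t_a + t_b + s]`. -/
def IsAdmissible {k : ℕ} (δ s : ℝ) (t : Fin k → ℝ) : Prop :=
  StrictMono t ∧ (∀ l : Fin k, 1 ≤ t l) ∧
    ∀ a b c : Fin k, a ≤ b → b < c →
      t c ∉ Set.Icc ((1 - δ) * (t a + t b)) (t a + t b + s)

open Classical in
/-- The number of (unordered) pairs of points whose distance lies in
`⋃ l, [t_l, t_l + α]`; every unordered pair `{i, j}` is represented by `(i, j)` with `i < j`. -/
noncomputable def pairCount {n k : ℕ} (p : Fin n → EuclideanSpace ℝ (Fin 2))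
    (t : Fin k → ℝ) (α : ℝ) : ℕ :=
  (Finset.univ.filter fun q : Fin n × Fin n =>
    q.1 < q.2 ∧ dist (p q.1) (p q.2) ∈ ⋃ l : Fin k, Set.Icc (t l) (t l + α)).card

/-! Upper bound: join two points if their distance lies in one of the intervals. Among the edges
inside a vertex set, choose `xy` in the interval of largest index `c`. A common neighbour `z` has
its distances to `x` and `y` in intervals `a, b ≤ c`. The triangle inequality rules out `t c > t a +
t b + 2 * α`, so admissibility makes the triangle `xyz` far from flat. Two annuli of width `α`
crossing at such an angle meet in two pieces of bounded diameter, one on each side of `xy`, and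
separation leaves boundedly many points there (`card_common_neighbors_le`). Hence the degrees of `x`
and `y` add up to at most `|S| + O(1)`. Deleting both and inducting gives `n ^ 2 / 4 + O(n)`
(`card_adj_pairs_le`).

Lower bound: put integer points on two parallel lines at distance `T`. If `n ^ 2 ≤ T * ε`, all cross
distances lie in `[T, T + ε]`, and the other `k - 1` intervals start at integers, each realised
about `n` times within the lines. If `T` is too small for this choice of `t`, then `T` is bounded in
terms of `k`, and one line already gives `n ^ 2 / 2 - O(n)` pairs. -/

theorem dist_sq_fin_two (x y : EuclideanSpace ℝ (Fin 2)) :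
    dist x y ^ 2 = (x 0 - y 0) ^ 2 + (x 1 - y 1) ^ 2 := by
  rw [EuclideanSpace.dist_sq_eq, Fin.sum_univ_two, Real.dist_eq, Real.dist_eq, sq_abs, sq_abs]

/-- A `1`-separated family in a disc of radius `D` has a bounded number of members. -/
theorem card_le_of_separated_of_dist_le {ι : Type*} (D : ℝ) (q : EuclideanSpace ℝ (Fin 2))
    (p : ι → EuclideanSpace ℝ (Fin 2)) (hp : ∀ i j, i ≠ j → 1 ≤ dist (p i) (p j))
    (S : Finset ι) (hS : ∀ i ∈ S, dist (p i) q ≤ D) :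
    S.card ≤ (2 * ⌈2 * D⌉₊ + 2) ^ 2 := by
  classical
  set m : ℕ := ⌈2 * D⌉₊ with hm
  have hmD : 2 * D ≤ m := Nat.le_ceil _
  have hcoord : ∀ i ∈ S, ∀ l : Fin 2,
      ⌊2 * (p i l - q l)⌋ ∈ Finset.Icc (-(m : ℤ) - 1) m := by
    intro i hi l
    have h1 := dist_sq_fin_two (p i) q
    have h2 := hS i hi
    have h0 : 0 ≤ dist (p i) q := dist_nonneg
    have h3 : |p i l - q l| ≤ D := by
      apply abs_le_of_sq_le_sq _ (h0.trans h2)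
      have : dist (p i) q ^ 2 ≤ D ^ 2 := by gcongr
      fin_cases l <;> simp <;> nlinarith [sq_nonneg (p i 0 - q 0), sq_nonneg (p i 1 - q 1)]
    rw [abs_le] at h3
    rw [Finset.mem_Icc, Int.le_floor]
    constructor
    · push_cast; linarith
    · have : (⌊2 * (p i l - q l)⌋ : ℝ) ≤ m := (Int.floor_le _).trans (by linarith)
      exact_mod_cast this
  -- A square cell of side `1 / 2` has diameter below `1`, so it holds at most one point.
  have hle := Finset.card_le_card_of_injOn
    (s := S) (t := Finset.Icc (-(m : ℤ) - 1) m ×ˢ Finset.Icc (-(m : ℤ) - 1) m)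
    (fun i => (⌊2 * (p i 0 - q 0)⌋, ⌊2 * (p i 1 - q 1)⌋))
    (fun i hi => by
      simp only [Finset.coe_product, Set.mem_prod, Finset.mem_coe]
      exact ⟨hcoord i hi 0, hcoord i hi 1⟩)
    (by
      intro i _ j _ hij
      by_contra hne
      simp only [Prod.mk.injEq] at hij
      have h0 := abs_lt.1 (Int.abs_sub_lt_one_of_floor_eq_floor hij.1)
      have h1 := abs_lt.1 (Int.abs_sub_lt_one_of_floor_eq_floor hij.2)
      have h2 := hp i j hne
      have h3 := dist_sq_fin_two (p i) (p j)
      nlinarith)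
  refine hle.trans (le_of_eq ?_)
  rw [Finset.card_product, Int.card_Icc, sq]
  congr 1 <;> omega

/-! ### Apices of non-flat triangles over a fixed side -/

/-- The sine of the angle between the sides `u` and `d` of a triangle with sides `u, v, d` is
bounded from below; `A` and `B` stand for the inner and the cross product of these sides. -/
theorem le_abs_cross {α δ u v d A B : ℝ} (hα : 0 < α) (hδ : 0 < δ) (hδ1 : δ < 1)
    (hu : 8 * α / δ ≤ u) (hd : 8 * α / δ ≤ d)
    (hvd : v ≤ d + α) (huv : u ≤ v + α) (hflat : δ / 2 * u ≤ u + v - d)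
    (hA : 2 * A = u ^ 2 + d ^ 2 - v ^ 2) (hB : A ^ 2 + B ^ 2 = u ^ 2 * d ^ 2) :
    δ / 6 * (u * d) ≤ |B| := by
  have h8 : 8 * α ≤ 8 * α / δ := by rw [le_div_iff₀ hδ]; nlinarith
  have hu0 : 0 < u := by linarith
  have hd0 : 0 < d := by linarith
  -- Heron's factorisation: `2 * (u * d - A) = v ^ 2 - (u - d) ^ 2`, `2 * (u * d + A) = (u + d) ^ 2
  -- - v ^ 2`, and `B ^ 2` is the product of `u * d - A` and `u * d + A`.
  have h1 : δ / 8 * (u * d) ≤ u * d - A := by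
    have : (δ / 2 * u) * (d / 2) ≤ (v - d + u) * (v + d - u) :=
      mul_le_mul (by linarith) (by linarith) (by linarith)
        ((by positivity : 0 ≤ δ / 2 * u).trans (by linarith))
    nlinarith
  have h2 : 1 / 4 * (u * d) ≤ u * d + A := by
    have : (u / 2) * d ≤ (u + d - v) * (u + d + v) :=
      mul_le_mul (by linarith) (by linarith) (by linarith) (by linarith)
    nlinarith
  have h3 : (δ / 8 * (u * d)) * (1 / 4 * (u * d)) ≤ (u * d - A) * (u * d + A) :=
    mul_le_mul h1 h2 (by positivity) ((by positivity : 0 ≤ δ / 8 * (u * d)).trans h1)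
  have h4 : (δ / 6 * (u * d)) ^ 2 ≤ B ^ 2 := by
    have : δ ^ 2 * (u * d) ^ 2 ≤ δ * (u * d) ^ 2 := by gcongr; nlinarith
    nlinarith [sq_nonneg (u * d), mul_nonneg hδ.le (sq_nonneg (u * d))]
  exact (le_abs_self _).trans (sq_le_sq.1 h4)

/-- Two triangles with a common side `d`, nearly equal further sides and the same orientation have
nearby apices; `A, A'` and `B, B'` are the inner and cross products with the common side. -/
theorem le_of_same_orientation {α δ d u v u' v' r A A' B B' : ℝ}
    (hα : 0 < α) (hδ : 0 < δ) (hδ1 : δ < 1)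
    (hd : 8 * α / δ ≤ d) (hz : 8 * α / δ ≤ u) (hw : 8 * α / δ ≤ u')
    (hzx : u ≤ d + α) (hwx : u' ≤ d + α) (hzy : v ≤ d + α) (hwy : v' ≤ d + α)
    (hzxy : u ≤ v + α) (hwxy : u' ≤ v' + α)
    (hzf : δ / 2 * u ≤ u + v - d) (hwf : δ / 2 * u' ≤ u' + v' - d)
    (hx : |u - u'| ≤ α) (hy : |v - v'| ≤ α) (hside : 0 ≤ B * B')
    (f1 : 2 * A = u ^ 2 + d ^ 2 - v ^ 2) (f2 : 2 * A' = u' ^ 2 + d ^ 2 - v' ^ 2)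
    (f3 : A ^ 2 + B ^ 2 = u ^ 2 * d ^ 2) (f4 : A' ^ 2 + B' ^ 2 = u' ^ 2 * d ^ 2)
    (f5 : (r * d) ^ 2 = (A - A') ^ 2 + (B - B') ^ 2) :
    r ≤ 31 * α / δ := by
  have h8 : 8 * α ≤ 8 * α / δ := by rw [le_div_iff₀ hδ]; nlinarith
  have g1 := le_abs_cross hα hδ hδ1 hz hd hzy hzxy hzf f1 f3
  have g2 := le_abs_cross hα hδ hδ1 hw hd hwy hwxy hwf f2 f4
  have hd0 : 0 < d := by linarith
  have hu0 : 0 < u := by linarith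
  have hu'0 : 0 < u' := by linarith
  have hv0 : 0 < v := by linarith
  have hv'0 : 0 < v' := by linarith
  have hAd : |A - A'| ≤ 4 * α * d := by
    have k1 : |(u - u') * (u + u')| ≤ α * (u + u') := by
      rw [abs_mul, abs_of_pos (by linarith : 0 < u + u')]; gcongr
    have k2 : |(v - v') * (v + v')| ≤ α * (v + v') := by
      rw [abs_mul, abs_of_pos (by linarith : 0 < v + v')]; gcongr
    have k3 : α * (u + u' + v + v') ≤ α * (8 * d) := by gcongr; linarith
    have k4 : 2 * (A - A') = (u - u') * (u + u') - (v - v') * (v + v') := by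
      linear_combination f1 - f2
    rw [abs_le] at k1 k2 ⊢
    constructor <;> linarith
  have hAle : |A| ≤ u * d :=
    abs_le_of_sq_le_sq (by rw [mul_pow]; linarith [sq_nonneg B]) (by positivity)
  have hA'le : |A'| ≤ u' * d :=
    abs_le_of_sq_le_sq (by rw [mul_pow]; linarith [sq_nonneg B']) (by positivity)
  -- The difference of squares is easy to bound. Equal orientation keeps `|B + B'|` large, so
  -- dividing by it controls `|B - B'|`.
  have hBsq : |B - B'| * |B + B'| ≤ 5 * α * d ^ 2 * (u + u') := by
    have k0 : (B - B') * (B + B') = d ^ 2 * ((u - u') * (u + u')) - (A - A') * (A + A') := by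
      linear_combination f3 - f4
    have k1 : |d ^ 2 * ((u - u') * (u + u'))| ≤ d ^ 2 * (α * (u + u')) := by
      rw [abs_mul, abs_mul, abs_of_pos (by linarith : 0 < u + u'),
        abs_of_pos (by positivity : 0 < d ^ 2)]
      gcongr
    have k2 : |(A - A') * (A + A')| ≤ (4 * α * d) * (u * d + u' * d) := by
      rw [abs_mul]
      gcongr
      exact (abs_add_le _ _).trans (by linarith)
    rw [← abs_mul, k0]
    refine (abs_sub _ _).trans ((add_le_add k1 k2).trans (le_of_eq ?_))
    ring
  have hBs : |B + B'| = |B| + |B'| := by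
    rcases le_total 0 B with hb | hb <;> rcases le_total 0 B' with hb' | hb' 
    · exact abs_add_eq_add_abs_iff _ _ |>.2 (Or.inl ⟨hb, hb'⟩)
    · have : B * B' = 0 := le_antisymm (mul_nonpos_of_nonneg_of_nonpos hb hb') hside
      rcases mul_eq_zero.1 this with h | h <;> simp [h]
    · have : B * B' = 0 := le_antisymm (mul_nonpos_of_nonpos_of_nonneg hb hb') hside
      rcases mul_eq_zero.1 this with h | h <;> simp [h]
    · exact abs_add_eq_add_abs_iff _ _ |>.2 (Or.inr ⟨hb, hb'⟩)
  have hBd : |B - B'| ≤ 30 * α / δ * d := by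
    have k1 : δ / 6 * ((u + u') * d) ≤ |B + B'| := by rw [hBs]; linarith
    have k2 : |B - B'| * (δ / 6 * ((u + u') * d)) ≤ 5 * α * d ^ 2 * (u + u') :=
      (mul_le_mul_of_nonneg_left k1 (abs_nonneg _)).trans hBsq
    have k3 : 0 < (u + u') * d := by positivity
    have k4 : |B - B'| * δ * ((u + u') * d) ≤ (30 * α * d) * ((u + u') * d) := by linarith
    have k5 := le_of_mul_le_mul_right k4 k3
    rw [div_mul_eq_mul_div, le_div_iff₀ hδ]
    exact k5
  have hA2 : (A - A') ^ 2 ≤ (4 * (α / δ) * d) ^ 2 := by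
    rw [← sq_abs]
    have : α ≤ α / δ := by rw [le_div_iff₀ hδ]; nlinarith
    have : |A - A'| ≤ 4 * (α / δ) * d := hAd.trans (by gcongr)
    gcongr
  have hB2 : (B - B') ^ 2 ≤ (30 * (α / δ) * d) ^ 2 := by
    rw [← sq_abs]
    have : |B - B'| ≤ 30 * (α / δ) * d := hBd.trans (le_of_eq (by ring))
    gcongr
  -- `4 ^ 2 + 30 ^ 2 ≤ 31 ^ 2`.
  have : r * d ≤ 31 * α / δ * d := by
    refine le_of_sq_le_sq ?_ (by positivity)
    rw [mul_div_assoc]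
    have k1 : 0 ≤ (α / δ * d) ^ 2 := sq_nonneg _
    have k2 : (4 * (α / δ) * d) ^ 2 = 16 * (α / δ * d) ^ 2 := by ring
    have k3 : (30 * (α / δ) * d) ^ 2 = 900 * (α / δ * d) ^ 2 := by ring
    have k4 : (31 * (α / δ) * d) ^ 2 = 961 * (α / δ * d) ^ 2 := by ring
    linarith
  exact le_of_mul_le_mul_right this hd0

/-- Inner and cross products with `y - x` are, up to the factor `dist x y`, coordinates in an
orthonormal frame along `xy`; `hside` puts `z` and `w` on the same closed side of that line. -/
theorem dist_le_of_same_side {α δ : ℝ} (hα : 0 < α) (hδ : 0 < δ) (hδ1 : δ < 1)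
    {x y z w : EuclideanSpace ℝ (Fin 2)}
    (hd : 8 * α / δ ≤ dist x y) (hz : 8 * α / δ ≤ dist z x) (hw : 8 * α / δ ≤ dist w x)
    (hzx : dist z x ≤ dist x y + α) (hwx : dist w x ≤ dist x y + α)
    (hzy : dist z y ≤ dist x y + α) (hwy : dist w y ≤ dist x y + α)
    (hzxy : dist z x ≤ dist z y + α) (hwxy : dist w x ≤ dist w y + α)
    (hzf : δ / 2 * dist z x ≤ dist z x + dist z y - dist x y)
    (hwf : δ / 2 * dist w x ≤ dist w x + dist w y - dist x y)
    (hx : |dist z x - dist w x| ≤ α) (hy : |dist z y - dist w y| ≤ α)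
    (hside : 0 ≤ ((z 0 - x 0) * (y 1 - x 1) - (z 1 - x 1) * (y 0 - x 0)) *
      ((w 0 - x 0) * (y 1 - x 1) - (w 1 - x 1) * (y 0 - x 0))) :
    dist z w ≤ 31 * α / δ := by
  have e1 := dist_sq_fin_two x y
  have e2 := dist_sq_fin_two z x
  have e3 := dist_sq_fin_two z y
  have e4 := dist_sq_fin_two w x
  have e5 := dist_sq_fin_two w y
  have e6 := dist_sq_fin_two z w
  refine le_of_same_orientation
    (A := (z 0 - x 0) * (y 0 - x 0) + (z 1 - x 1) * (y 1 - x 1))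
    (A' := (w 0 - x 0) * (y 0 - x 0) + (w 1 - x 1) * (y 1 - x 1))
    hα hδ hδ1 hd hz hw hzx hwx hzy hwy hzxy hwxy hzf hwf hx hy hside ?_ ?_ ?_ ?_ ?_
  · rw [e1, e2, e3]; ring
  · rw [e1, e4, e5]; ring
  · rw [e1, e2]; ring
  · rw [e1, e4]; ring
  · rw [mul_pow, e1, e6]; ring

/-! ### Edge count from an edge of small codegree -/

open Finset in
/-- If every set of vertices spanning an edge spans an edge whose ends have few common neighbours,
then there are at most about `n ^ 2 / 4` edges. -/
theorem card_adj_pairs_le {V : Type*} [DecidableEq V] (r : V → V → Prop) [DecidableRel r]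
    (hsymm : ∀ x y, r x y → r y x) (hirr : ∀ x, ¬ r x x) (C : ℕ)
    (h : ∀ S : Finset V, (∃ x ∈ S, ∃ y ∈ S, r x y) →
      ∃ x ∈ S, ∃ y ∈ S, r x y ∧ #{z ∈ S | r z x ∧ r z y} ≤ C) (S : Finset V) :
    (#{q ∈ S ×ˢ S | r q.1 q.2} : ℝ) ≤ (#S : ℝ) ^ 2 / 2 + (C + 1) * #S := by
  induction S using Finset.strongInduction with
  | H S ih =>
    by_cases hS : ∃ x ∈ S, ∃ y ∈ S, r x y
    · obtain ⟨x, hx, y, hy, hxy, hC⟩ := h S hS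
      have hne : y ≠ x := by rintro rfl; exact hirr _ hxy
      have hy' : y ∈ S.erase x := mem_erase.2 ⟨hne, hy⟩
      set S' := (S.erase x).erase y with hS'
      have hcard : #S = #S' + 2 := by
        rw [hS', ← card_erase_add_one hx, ← card_erase_add_one hy']
      have hss : S' ⊂ S := (erase_ssubset hy').trans (erase_ssubset hx)
      have hsub : #{q ∈ S ×ˢ S | r q.1 q.2} ≤ #{q ∈ S' ×ˢ S' | r q.1 q.2} +
          2 * (#{z ∈ S | r z x} + #{z ∈ S | r z y}) := by
        have : {q ∈ S ×ˢ S | r q.1 q.2} ⊆ {q ∈ S' ×ˢ S' | r q.1 q.2} ∪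
            (({z ∈ S | r z x} ×ˢ {x} ∪ {x} ×ˢ {z ∈ S | r z x}) ∪
              ({z ∈ S | r z y} ×ˢ {y} ∪ {y} ×ˢ {z ∈ S | r z y})) := by
          rintro ⟨a, b⟩ hab
          simp only [hS', mem_union, mem_filter, mem_product, mem_singleton, mem_erase] at hab ⊢
          have := hsymm a b
          grind
        refine (card_le_card this).trans ?_
        refine (card_union_le _ _).trans (Nat.add_le_add_left ?_ _)
        refine (card_union_le _ _).trans ?_
        refine (Nat.add_le_add (card_union_le _ _) (card_union_le _ _)).trans ?_
        simp only [card_product, card_singleton]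
        omega
      have hdeg : #{z ∈ S | r z x} + #{z ∈ S | r z y} ≤ #S + C := by
        rw [← card_union_add_card_inter, ← filter_and]
        exact Nat.add_le_add
          (card_le_card (union_subset (filter_subset _ _) (filter_subset _ _))) hC
      have h1 := ih S' hss
      have h2 : (#{q ∈ S ×ˢ S | r q.1 q.2} : ℝ) ≤ #{q ∈ S' ×ˢ S' | r q.1 q.2} +
          2 * (#S + C) := by
        exact_mod_cast hsub.trans (by omega)
      have h3 : (#S : ℝ) = #S' + 2 := by exact_mod_cast hcard
      -- The claimed bound satisfies the recursion `f (m + 2) = f m + 2 * (m + 2 + C)` with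
      -- equality.
      rw [h3] at h2 ⊢
      linarith
    · have : ({q ∈ S ×ˢ S | r q.1 q.2} : Finset (V × V)) = ∅ := by
        refine filter_eq_empty_iff.2 fun q hq hr => hS ?_
        rw [mem_product] at hq
        exact ⟨_, hq.1, _, hq.2, hr⟩
      rw [this, card_empty]
      push_cast
      positivity

/-! ### Codegrees and the upper bound -/

/-- The number of points in the intersection of two annuli around the ends of a segment whose
length is nearly equal to the largest of three admissible numbers. -/
theorem card_common_neighbors_le {ι : Type*} {α δ : ℝ} (hα : 0 < α) (hδ : 0 < δ) (hδ1 : δ < 1)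
    (p : ι → EuclideanSpace ℝ (Fin 2)) (hp : ∀ i j, i ≠ j → 1 ≤ dist (p i) (p j))
    {x y : EuclideanSpace ℝ (Fin 2)} {a b c : ℝ} (ha : 8 * α / δ ≤ a) (hab : a ≤ b) (hbc : b ≤ c)
    (hxy : dist x y ∈ Set.Icc c (c + α))
    (hadm : b = c ∨ c ∉ Set.Icc ((1 - δ) * (a + b)) (a + b + 2 * α))
    (S : Finset ι)
    (hS : ∀ z ∈ S, dist (p z) x ∈ Set.Icc a (a + α) ∧ dist (p z) y ∈ Set.Icc b (b + α)) :
    S.card ≤ 2 * (2 * ⌈2 * (31 * α / δ)⌉₊ + 2) ^ 2 := by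
  classical
  have h8 : 8 * α ≤ 8 * α / δ := by rw [le_div_iff₀ hδ]; nlinarith
  have hd8 : δ * (8 * α / δ) = 8 * α := by field_simp
  have hflat : ∀ z ∈ S, δ / 2 * dist (p z) x ≤ dist (p z) x + dist (p z) y - dist x y := by
    intro z hz
    obtain ⟨⟨h1, h2⟩, h3, h4⟩ := hS z hz
    obtain ⟨h5, h6⟩ := hxy
    rcases hadm with rfl | hadm
    · nlinarith
    · have htri : dist x y ≤ dist (p z) x + dist (p z) y := dist_triangle_left _ _ _
      -- The slack `2 * α` is the sum of the widths of the two annuli, so the triangle inequality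
      -- excludes the upper alternative.
      have hc : c < (1 - δ) * (a + b) := by
        by_contra hc
        exact hadm ⟨not_lt.1 hc, by linarith⟩
      have k1 : (1 - δ) * (a + b) ≤ (1 - δ) * (dist (p z) x + dist (p z) y) := by
        have : 0 ≤ 1 - δ := by linarith
        gcongr
      have k2 : δ * (8 * α / δ) ≤ δ * dist (p z) y := by gcongr; linarith
      have k3 : 0 ≤ δ * dist (p z) x := by positivity
      linarith
  set f : ι → ℝ := fun z => (p z 0 - x 0) * (y 1 - x 1) - (p z 1 - x 1) * (y 0 - x 0) with hf
  have key : ∀ T ⊆ S, (∀ z ∈ T, ∀ w ∈ T, 0 ≤ f z * f w) →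
      T.card ≤ (2 * ⌈2 * (31 * α / δ)⌉₊ + 2) ^ 2 := by
    intro T hT hside
    rcases T.eq_empty_or_nonempty with rfl | ⟨w, hw⟩
    · simp
    refine card_le_of_separated_of_dist_le _ (p w) p hp T fun z hz => ?_
    obtain ⟨⟨h1, h2⟩, h3, h4⟩ := hS z (hT hz)
    obtain ⟨⟨h1', h2'⟩, h3', h4'⟩ := hS w (hT hw)
    obtain ⟨h5, h6⟩ := hxy
    refine dist_le_of_same_side hα hδ hδ1 (x := x) (y := y) ?_ ?_ ?_ ?_ ?_ ?_ ?_ ?_ ?_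
      (hflat z (hT hz)) (hflat w (hT hw)) ?_ ?_ (hside z hz w hw)
    any_goals linarith
    all_goals rw [abs_le]; constructor <;> linarith
  have hS2 : (S.filter fun z => 0 ≤ f z).card + (S.filter fun z => ¬ 0 ≤ f z).card = S.card :=
    Finset.card_filter_add_card_filter_not _
  have k1 := key (S.filter fun z => 0 ≤ f z) (Finset.filter_subset _ _) fun z hz w hw =>
    mul_nonneg (Finset.mem_filter.1 hz).2 (Finset.mem_filter.1 hw).2
  have k2 := key (S.filter fun z => ¬ 0 ≤ f z) (Finset.filter_subset _ _) fun z hz w hw =>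
    mul_nonneg_of_nonpos_of_nonpos (not_le.1 (Finset.mem_filter.1 hz).2).le
      (not_le.1 (Finset.mem_filter.1 hw).2).le
  omega

/-- Bridge to `card_adj_pairs_le`, which counts ordered pairs. -/
theorem two_mul_pairCount {n k : ℕ} (p : Fin n → EuclideanSpace ℝ (Fin 2)) (t : Fin k → ℝ) (α : ℝ)
    (r : Fin n → Fin n → Prop) [DecidableRel r]
    (hr : ∀ i j, r i j ↔ i ≠ j ∧ dist (p i) (p j) ∈ ⋃ l : Fin k, Set.Icc (t l) (t l + α)) :
    2 * pairCount p t α =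
      (Finset.filter (fun q : Fin n × Fin n => r q.1 q.2) (Finset.univ ×ˢ Finset.univ)).card := by
  classical
  have hsymm : ∀ i j, r i j ↔ r j i := fun i j => by
    rw [hr, hr, dist_comm, ne_comm]
  have h1 : pairCount p t α = (Finset.univ.filter fun q : Fin n × Fin n =>
      q.1 < q.2 ∧ r q.1 q.2).card := by
    unfold pairCount
    congr 1
    ext q
    simp only [Finset.mem_filter, Finset.mem_univ, true_and, hr]
    exact ⟨fun h => ⟨h.1, h.1.ne, h.2⟩, fun h => ⟨h.1, h.2.2⟩⟩
  have h2 : (Finset.univ.filter fun q : Fin n × Fin n => q.1 < q.2 ∧ r q.1 q.2).card =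
      (Finset.univ.filter fun q : Fin n × Fin n => q.2 < q.1 ∧ r q.1 q.2).card := by
    refine Finset.card_bij (fun q _ => q.swap) ?_ ?_ ?_
    · intro q hq
      simpa [hsymm q.2 q.1] using hq
    · intro a _ b _ hab
      exact Prod.swap_injective hab
    · intro q hq
      exact ⟨q.swap, by simpa [hsymm q.2 q.1] using hq, by simp⟩
  rw [two_mul, h1]
  nth_rewrite 2 [h2]
  rw [← Finset.card_union_of_disjoint]
  · congr 1
    ext q
    simp only [Finset.mem_filter, Finset.mem_union, Finset.mem_univ, true_and,
      Finset.univ_product_univ, ← or_and_right, and_iff_right_iff_imp]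
    exact fun h => lt_or_gt_of_ne ((hr _ _).1 h).1
  · rw [Finset.disjoint_left]
    intro q hq hq'
    exact lt_asymm (Finset.mem_filter.1 hq).2.1 (Finset.mem_filter.1 hq').2.1

theorem pairCount_le (k : ℕ) {δ α : ℝ} (hδ : 0 < δ) (hδ1 : δ < 1) (hα : 0 < α) :
    ∃ C : ℝ, 0 < C ∧ ∀ n : ℕ, ∀ t : Fin k → ℝ, IsAdmissible δ (2 * α) t →
      ∀ p : Fin n → EuclideanSpace ℝ (Fin 2), IsSeparated1 p →
        (pairCount p t α : ℝ) ≤ (n : ℝ) ^ 2 / 4 + C * n := by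
  classical
  set N₀ : ℕ := (2 * ⌈2 * (8 * α / δ + α)⌉₊ + 2) ^ 2 with hN₀
  set N₁ : ℕ := 2 * (2 * ⌈2 * (31 * α / δ)⌉₊ + 2) ^ 2 with hN₁
  set C₀ : ℕ := k * k * (N₀ + N₁) with hC₀
  refine ⟨C₀ + 1, by positivity, fun n t ht p hp => ?_⟩
  let r : Fin n → Fin n → Prop := fun i j =>
    i ≠ j ∧ dist (p i) (p j) ∈ ⋃ l : Fin k, Set.Icc (t l) (t l + α)
  have hsymm : ∀ i j, r i j → r j i := fun i j h => ⟨h.1.symm, by rw [dist_comm]; exact h.2⟩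
  have hmain := card_adj_pairs_le r hsymm (fun i h => h.1 rfl) C₀ ?_ Finset.univ
  · rw [← two_mul_pairCount p t α r (fun _ _ => Iff.rfl), Finset.card_univ,
      Fintype.card_fin] at hmain
    push_cast at hmain
    have : (0 : ℝ) ≤ (C₀ + 1) * n := by positivity
    linarith
  rintro S ⟨x₀, hx₀, y₀, hy₀, hr₀⟩
  -- Only intervals realised inside `S` compete, so the maximal index also bounds the indices of all
  -- edges from `x` and `y` within `S`.
  set cs : Finset (Fin k) := Finset.univ.filter fun l => ∃ x ∈ S, ∃ y ∈ S, x ≠ y ∧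
    dist (p x) (p y) ∈ Set.Icc (t l) (t l + α) with hcs
  have hcsne : cs.Nonempty := by
    obtain ⟨l, hl⟩ := Set.mem_iUnion.1 hr₀.2
    exact ⟨l, Finset.mem_filter.2 ⟨Finset.mem_univ _, x₀, hx₀, y₀, hy₀, hr₀.1, hl⟩⟩
  obtain ⟨c, hc, hmax⟩ := cs.exists_max_image id hcsne
  obtain ⟨x, hx, y, hy, hxy, hd⟩ := (Finset.mem_filter.1 hc).2
  refine ⟨x, hx, y, hy, ⟨hxy, Set.mem_iUnion.2 ⟨c, hd⟩⟩, ?_⟩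
  let G : Fin k × Fin k → Finset (Fin n) := fun q => S.filter fun z => z ≠ x ∧ z ≠ y ∧
    dist (p z) (p x) ∈ Set.Icc (t q.1) (t q.1 + α) ∧
    dist (p z) (p y) ∈ Set.Icc (t q.2) (t q.2 + α)
  have hsub : (S.filter fun z => r z x ∧ r z y) ⊆ Finset.univ.biUnion G := by
    intro z hz
    obtain ⟨hzS, ⟨hzx, h1⟩, hzy, h2⟩ := Finset.mem_filter.1 hz
    obtain ⟨a, ha⟩ := Set.mem_iUnion.1 h1
    obtain ⟨b, hb⟩ := Set.mem_iUnion.1 h2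
    exact Finset.mem_biUnion.2 ⟨(a, b), Finset.mem_univ _,
      Finset.mem_filter.2 ⟨hzS, hzx, hzy, ha, hb⟩⟩
  have hG : ∀ q ∈ (Finset.univ : Finset (Fin k × Fin k)), (G q).card ≤ N₀ + N₁ := by
    rintro ⟨a, b⟩ -
    rcases (G (a, b)).eq_empty_or_nonempty with h0 | ⟨z₀, hz₀⟩
    · rw [h0]; simp
    obtain ⟨hzS, hzx, hzy, hza, hzb⟩ := Finset.mem_filter.1 hz₀
    have hac : a ≤ c := hmax a (Finset.mem_filter.2 ⟨Finset.mem_univ _, z₀, hzS, x, hx, hzx, hza⟩)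
    have hbc : b ≤ c := hmax b (Finset.mem_filter.2 ⟨Finset.mem_univ _, z₀, hzS, y, hy, hzy, hzb⟩)
    have hGx : ∀ z ∈ G (a, b), dist (p z) (p x) ∈ Set.Icc (t a) (t a + α) ∧
        dist (p z) (p y) ∈ Set.Icc (t b) (t b + α) :=
      fun z hz => (Finset.mem_filter.1 hz).2.2.2
    -- A short side confines `z` to a disc of bounded radius; the angle estimate is needed only for
    -- long sides.
    rcases lt_or_ge (t a) (8 * α / δ) with hta | hta
    · refine (card_le_of_separated_of_dist_le _ (p x) p hp _ fun z hz => ?_).trans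
        (Nat.le_add_right N₀ N₁)
      have := (hGx z hz).1.2
      linarith
    rcases lt_or_ge (t b) (8 * α / δ) with htb | htb
    · refine (card_le_of_separated_of_dist_le _ (p y) p hp _ fun z hz => ?_).trans
        (Nat.le_add_right N₀ N₁)
      have := (hGx z hz).2.2
      linarith
    refine le_trans ?_ (Nat.le_add_left N₁ N₀)
    have hadm : ∀ a b : Fin k, a ≤ b → b ≤ c → t b = t c ∨
        t c ∉ Set.Icc ((1 - δ) * (t a + t b)) (t a + t b + 2 * α) := by
      intro a b hab hbc
      rcases hbc.eq_or_lt with rfl | hlt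
      · exact Or.inl rfl
      · exact Or.inr (ht.2.2 a b c hab hlt)
    rcases le_total a b with hab | hab
    · exact card_common_neighbors_le hα hδ hδ1 p hp hta (ht.1.monotone hab) (ht.1.monotone hbc) hd
        (hadm a b hab hbc) _ hGx
    · exact card_common_neighbors_le hα hδ hδ1 p hp htb (ht.1.monotone hab) (ht.1.monotone hac)
        (by rwa [dist_comm]) (hadm b a hab hac) _ fun z hz => (hGx z hz).symm
  refine (Finset.card_le_card hsub).trans ((Finset.card_biUnion_le_card_mul _ _ _ hG).trans ?_)
  simp [hC₀]

/-! ### Constructions for the lower bound -/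

theorem four_mul_sum_half (n : ℕ) :
    n ^ 2 ≤ 4 * (∑ j ∈ Finset.range n, (j + 1) / 2) + 1 := by
  have h : ∑ j ∈ Finset.range n, (j + 1) / 2 = (n / 2) * ((n + 1) / 2) := by
    induction n with
    | zero => rfl
    | succ n ih =>
      rw [Finset.sum_range_succ, ih]
      obtain ⟨m, rfl | rfl⟩ := Nat.even_or_odd' n
      · rw [show 2 * m / 2 = m by omega, show (2 * m + 1) / 2 = m by omega,
          show (2 * m + 1 + 1) / 2 = m + 1 by omega]
        ring
      · rw [show (2 * m + 1) / 2 = m by omega, show (2 * m + 1 + 1) / 2 = m + 1 by omega,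
          show (2 * m + 1 + 1 + 1) / 2 = m + 1 by omega]
        ring
  rw [h]
  obtain ⟨m, rfl | rfl⟩ := Nat.even_or_odd' n
  · rw [show 2 * m / 2 = m by omega, show (2 * m + 1) / 2 = m by omega]
    nlinarith
  · rw [show (2 * m + 1) / 2 = m by omega, show (2 * m + 1 + 1) / 2 = m + 1 by omega]
    nlinarith

theorem mul_le_sum_ite_add (K m n : ℕ) :
    K * n ≤ (∑ j ∈ Finset.range n, if m ≤ j then K else 0) + K * m := by
  induction n with
  | zero => simp
  | succ n ih =>
    rw [Finset.sum_range_succ]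
    split_ifs with h
    · linarith
    · have : K * (n + 1) ≤ K * m := Nat.mul_le_mul_left _ (by omega)
      omega

/-- Reduces a lower bound to listing, for each `j`, some good partners of smaller index. -/
theorem sum_card_le_pairCount {n k : ℕ} (P : ℕ → EuclideanSpace ℝ (Fin 2)) (t : Fin k → ℝ) (α : ℝ)
    (f : ℕ → Finset ℕ)
    (hf : ∀ j < n, ∀ i ∈ f j, i < j ∧ ∃ l, dist (P i) (P j) ∈ Set.Icc (t l) (t l + α)) :
    ∑ j ∈ Finset.range n, (f j).card ≤ pairCount (fun i : Fin n => P i) t α := by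
  classical
  rw [← Finset.card_sigma]
  refine Finset.card_le_card_of_surjOn (fun q => ⟨q.2.val, q.1.val⟩) ?_
  rintro ⟨j, i⟩ hij
  obtain ⟨hj, hi⟩ := Finset.mem_sigma.1 (Finset.mem_coe.1 hij)
  have hj' : j < n := Finset.mem_range.1 hj
  obtain ⟨h1, h2⟩ := hf j hj' i hi
  refine ⟨(⟨i, h1.trans hj'⟩, ⟨j, hj'⟩), ?_, rfl⟩
  rw [Finset.mem_coe, Finset.mem_filter]
  exact ⟨Finset.mem_univ _, h1, Set.mem_iUnion.2 h2⟩

theorem dist_mk_fin_two (a b c d : ℝ) :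
    dist !₂[a, b] !₂[c, d] = √((a - c) ^ 2 + (b - d) ^ 2) := by
  rw [← Real.sqrt_sq dist_nonneg, dist_sq_fin_two]
  simp

/-- Equally spaced points on a line. -/
theorem exists_separated_line {k n Q : ℕ} {ε T : ℝ} (hε : 0 < ε) (hTQ : T ≤ Q)
    (t : Fin k → ℝ) (l : Fin k) (hl : t l = T) (hT0 : 0 < T) (hnT : (n : ℝ) ^ 2 ≤ T * ε) :
    ∃ p : Fin n → EuclideanSpace ℝ (Fin 2), IsSeparated1 p ∧
      (n : ℝ) ^ 2 / 4 + ((k : ℝ) - 1) * n - ((Q : ℝ) + k) ^ 2 ≤ pairCount p t ε := by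
  let P : ℕ → EuclideanSpace ℝ (Fin 2) := fun i => !₂[0, (i : ℝ)]
  have hP : ∀ i j, dist (P i) (P j) = |(i : ℝ) - j| := by
    intro i j
    rw [dist_mk_fin_two, ← Real.sqrt_sq_eq_abs]
    congr 1
    ring
  refine ⟨fun i => P i, fun i j hij => ?_, ?_⟩
  · rw [hP]
    have : ((i : ℕ) : ℤ) - (j : ℕ) ≠ 0 := by
      intro h
      exact hij (Fin.ext (by omega))
    exact_mod_cast Int.one_le_abs this
  -- The whole line has length below `T + ε`, so any two points more than `Q` apart form a good
  -- pair.
  have hn : (n : ℝ) ≤ T + ε := by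
    refine le_of_sq_le_sq (by nlinarith) (by positivity)
  have hcount := sum_card_le_pairCount (n := n) P t ε (fun j => Finset.range (j - Q)) (by
    intro j hj i hi
    have hij : i + Q < j := by have := Finset.mem_range.1 hi; omega
    have h1 : (i : ℝ) + Q < j := by exact_mod_cast hij
    have h2 : (j : ℝ) < n := by exact_mod_cast hj
    have h3 : (0 : ℝ) ≤ i := by positivity
    have h4 : (0 : ℝ) ≤ Q := by positivity
    refine ⟨by omega, l, ?_⟩
    rw [hP, hl, abs_of_nonpos (by linarith)]
    constructor <;> linarith)
  simp only [Finset.card_range] at hcount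
  have hsum : ∀ n : ℕ, (n : ℝ) ^ 2 / 2 - n / 2 - Q * n ≤
      ((∑ j ∈ Finset.range n, (j - Q) : ℕ) : ℝ) := by
    intro n
    induction n with
    | zero => simp
    | succ n ih =>
      rw [Finset.sum_range_succ]
      have : (n : ℝ) ≤ ((n - Q : ℕ) : ℝ) + Q := by exact_mod_cast (by omega : n ≤ (n - Q) + Q)
      push_cast at ih this ⊢
      linarith
  have h1 := hsum n
  have h2 : ((∑ j ∈ Finset.range n, (j - Q) : ℕ) : ℝ) ≤ pairCount (fun i : Fin n => P i) t ε := by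
    exact_mod_cast hcount
  have h3 : (0 : ℝ) ≤ n := by positivity
  -- The two sides differ by at least this square plus `n / 2`.
  nlinarith [sq_nonneg ((n : ℝ) / 2 - (Q + k))]

/-- Equally spaced points on two parallel lines. -/
theorem exists_separated_two_lines {k n : ℕ} {ε T : ℝ} (hε : 0 < ε)
    (t : Fin k → ℝ) (ht : ∀ l : Fin k, (l : ℕ) < k - 1 → t l = 2 * k + (l : ℕ))
    (e : Fin k) (he : (e : ℕ) = k - 1) (hT : t e = T) (hT1 : 1 ≤ T) (hnT : (n : ℝ) ^ 2 ≤ T * ε) :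
    ∃ p : Fin n → EuclideanSpace ℝ (Fin 2), IsSeparated1 p ∧
      (n : ℝ) ^ 2 / 4 + ((k : ℝ) - 1) * n - (6 * (k : ℝ) ^ 2 + 1) ≤ pairCount p t ε := by
  let P : ℕ → EuclideanSpace ℝ (Fin 2) := fun i => !₂[T * (i % 2 : ℕ), ((i / 2 : ℕ) : ℝ)]
  have hP : ∀ i j, dist (P i) (P j) = √((T * ((i % 2 : ℕ) - (j % 2 : ℕ))) ^ 2 +
      (((i / 2 : ℕ) : ℝ) - (j / 2 : ℕ)) ^ 2) := by
    intro i j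
    rw [dist_mk_fin_two, mul_sub]
  have hcross : ∀ i j, i % 2 ≠ j % 2 → dist (P i) (P j) =
      √(T ^ 2 + (((i / 2 : ℕ) : ℝ) - (j / 2 : ℕ)) ^ 2) := by
    intro i j hij
    rw [hP, mul_pow]
    rcases Nat.mod_two_eq_zero_or_one i with h | h <;>
      rcases Nat.mod_two_eq_zero_or_one j with h' | h' <;> simp [h, h'] at hij ⊢
  have hsame : ∀ i j, i % 2 = j % 2 → dist (P i) (P j) = |((i / 2 : ℕ) : ℝ) - (j / 2 : ℕ)| := by
    intro i j hij
    rw [hP, hij, ← Real.sqrt_sq_eq_abs]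
    congr 1
    ring
  refine ⟨fun i => P i, fun i j hij => ?_, ?_⟩
  · by_cases h : (i : ℕ) % 2 = j % 2
    · rw [hsame _ _ h]
      have : (((i : ℕ) / 2 : ℕ) : ℤ) - ((j : ℕ) / 2 : ℕ) ≠ 0 := by
        intro h'
        exact hij (Fin.ext (by omega))
      exact_mod_cast Int.one_le_abs this
    · rw [hcross _ _ h]
      refine Real.le_sqrt_of_sq_le ?_
      nlinarith [sq_nonneg ((((i : ℕ) / 2 : ℕ) : ℝ) - ((j : ℕ) / 2 : ℕ))]
  -- Parity of the index selects the line: `E j` lists the earlier points on the other line, `F j`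
  -- those on the same line at distance `2 * k + l`. The threshold `6 * k` keeps the natural
  -- subtraction in `F` from truncating.
  let E : ℕ → Finset ℕ := fun j => (Finset.range ((j + 1) / 2)).image fun a => j - (2 * a + 1)
  let F : ℕ → Finset ℕ := fun j => if 6 * k ≤ j then
    (Finset.range (k - 1)).image fun l => j - 2 * (2 * k + l) else ∅
  have hE : ∀ j, (E j).card = (j + 1) / 2 := by
    intro j
    rw [Finset.card_image_of_injOn, Finset.card_range]
    intro a ha b hb hab
    simp only [Finset.coe_range, Set.mem_Iio] at ha hb hab
    omega
  have hF : ∀ j, (F j).card = if 6 * k ≤ j then k - 1 else 0 := by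
    intro j
    by_cases h : 6 * k ≤ j
    · simp only [F, if_pos h]
      rw [Finset.card_image_of_injOn, Finset.card_range]
      intro a ha b hb hab
      simp only [Finset.coe_range, Set.mem_Iio] at ha hb hab
      omega
    · simp only [F, if_neg h, Finset.card_empty]
  have hEF : ∀ j, Disjoint (E j) (F j) := by
    intro j
    rw [Finset.disjoint_left]
    intro i hi hi'
    by_cases h : 6 * k ≤ j
    · simp only [F, if_pos h, E, Finset.mem_image, Finset.mem_range] at hi hi'
      omega
    · simp [F, if_neg h] at hi'
  have hcount := sum_card_le_pairCount (n := n) P t ε (fun j => E j ∪ F j) (by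
    intro j hj i hi
    rcases Finset.mem_union.1 hi with hi | hi
    · simp only [E, Finset.mem_image, Finset.mem_range] at hi
      obtain ⟨a, ha, rfl⟩ := hi
      refine ⟨by omega, e, ?_⟩
      set i := j - (2 * a + 1) with hidef
      rw [hcross _ _ (by omega), hT]
      have h1 : ((i / 2 : ℕ) : ℝ) ≤ n := by exact_mod_cast (by omega : i / 2 ≤ n)
      have h2 : ((j / 2 : ℕ) : ℝ) ≤ n := by exact_mod_cast (by omega : j / 2 ≤ n)
      have h3 : (0 : ℝ) ≤ (i / 2 : ℕ) := by positivity
      have h4 : (0 : ℝ) ≤ (j / 2 : ℕ) := by positivity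
      have h5 : (((i / 2 : ℕ) : ℝ) - (j / 2 : ℕ)) ^ 2 ≤ (n : ℝ) ^ 2 :=
        sq_le_sq' (by linarith) (by linarith)
      constructor
      · exact Real.le_sqrt_of_sq_le (by linarith [sq_nonneg (((i / 2 : ℕ) : ℝ) - (j / 2 : ℕ))])
      -- `T ^ 2 + n ^ 2 ≤ T ^ 2 + T * ε ≤ (T + ε) ^ 2`.
      · refine Real.sqrt_le_iff.2 ⟨by linarith, ?_⟩
        nlinarith
    · by_cases h : 6 * k ≤ j
      · simp only [F, if_pos h, Finset.mem_image, Finset.mem_range] at hi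
        obtain ⟨l, hl, rfl⟩ := hi
        refine ⟨by omega, ⟨l, by omega⟩, ?_⟩
        rw [hsame _ _ (by omega), ht _ hl]
        have h1 : j / 2 = (j - 2 * (2 * k + l)) / 2 + (2 * k + l) := by omega
        rw [h1]
        push_cast
        rw [abs_of_nonpos (by linarith [(by positivity : (0 : ℝ) ≤ 2 * k + l)])]
        constructor <;> linarith
      · simp [F, if_neg h] at hi)
  simp only [Finset.card_union_of_disjoint (hEF _), hE, hF, Finset.sum_add_distrib] at hcount
  have h1 := four_mul_sum_half n
  have h2 := mul_le_sum_ite_add (k - 1) (6 * k) n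
  have h3 : n ^ 2 + 4 * ((k - 1) * n) ≤
      4 * pairCount (fun i : Fin n => P i) t ε + 1 + 4 * ((k - 1) * (6 * k)) := by omega
  have h4 : (n : ℝ) ^ 2 + 4 * (((k : ℝ) - 1) * n) ≤
      4 * pairCount (fun i : Fin n => P i) t ε + 1 + 4 * (((k : ℝ) - 1) * (6 * k)) := by
    have : ((k - 1 : ℕ) : ℝ) = (k : ℝ) - 1 := by rw [Nat.cast_sub (by omega)]; simp
    rw [← this]
    exact_mod_cast h3
  have h5 : (0 : ℝ) ≤ k := by positivity
  nlinarith

/-- Numbers that increase slowly are admissible. -/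
theorem exists_isAdmissible_slow {k : ℕ} (hk : 2 ≤ k) (e : Fin k) (he : (e : ℕ) = k - 1) {δ T : ℝ}
    (hδ : δ ≤ 1 / 8) (hT : 3 ≤ T) (s : ℝ) : ∃ t : Fin k → ℝ, IsAdmissible δ s t ∧ t e = T := by
  have hk' : (2 : ℝ) ≤ k := by exact_mod_cast hk
  have hpos : (0 : ℝ) < 3 * k - 1 := by linarith
  have hlow : ∀ l : Fin k, T / (3 * k - 1) * (2 * k) ≤ T / (3 * k - 1) * (2 * k + (l : ℕ)) := by
    intro l
    have : 0 ≤ T / (3 * k - 1) := by positivity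
    gcongr
    simp
  have hq : T / (3 * k - 1) * (3 * k - 1) = T := by field_simp
  have hq0 : 0 < T / (3 * (k : ℝ) - 1) := by positivity
  -- All terms lie between `2 * T / 3` and `T`, so `7 / 8` of any sum of two exceeds `T`, whatever
  -- `s` is.
  refine ⟨fun l => T / (3 * k - 1) * (2 * k + (l : ℕ)), ⟨?_, ?_, ?_⟩, ?_⟩
  · intro a b hab
    have : ((a : ℕ) : ℝ) < (b : ℕ) := by exact_mod_cast hab
    dsimp only
    gcongr
  · intro l
    refine le_trans ?_ (hlow l)
    nlinarith
  · rintro a b c - - ⟨h, -⟩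
    have hc : ((c : ℕ) : ℝ) + 1 ≤ k := by exact_mod_cast c.2
    have h1 : T / (3 * k - 1) * (2 * k + (c : ℕ)) ≤ T := by
      calc _ ≤ T / (3 * k - 1) * (3 * k - 1) := by gcongr; linarith
        _ = T := hq
    have h2 := hlow a
    have h3 := hlow b
    dsimp only at h
    nlinarith
  · dsimp only
    rw [he, Nat.cast_sub (by omega)]
    push_cast
    rw [show (2 : ℝ) * k + (k - 1) = 3 * k - 1 by ring, hq]

/-- Among `2 * k, …, 3 * k - 2`, any term is below `7 / 8` of a sum of two, which is at least `7 * k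
/ 2`; the last term `T` exceeds every such sum by more than `s`. -/
theorem exists_isAdmissible_gap {k : ℕ} (hk : 2 ≤ k) (e : Fin k) (he : (e : ℕ) = k - 1) {δ s T : ℝ}
    (hδ : δ ≤ 1 / 8) (hs : 0 ≤ s) (hT : 6 * k + s ≤ T) :
    ∃ t : Fin k → ℝ, IsAdmissible δ s t ∧ t e = T ∧
      ∀ l : Fin k, (l : ℕ) < k - 1 → t l = 2 * k + (l : ℕ) := by
  have hk' : (2 : ℝ) ≤ k := by exact_mod_cast hk
  have hlt : ∀ l : Fin k, (l : ℕ) < k - 1 → ((l : ℕ) : ℝ) + 2 ≤ k := by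
    intro l hl
    exact_mod_cast (by omega : (l : ℕ) + 2 ≤ k)
  refine ⟨fun l => if (l : ℕ) < k - 1 then 2 * k + (l : ℕ) else T, ⟨?_, ?_, ?_⟩, by simp [he], ?_⟩
  · intro a b hab
    have hab' : (a : ℕ) < b := hab
    have ha : (a : ℕ) < k - 1 := by omega
    have := hlt a ha
    dsimp only
    rw [if_pos ha]
    split_ifs
    · gcongr
    · linarith
  · intro l
    have : (0 : ℝ) ≤ (l : ℕ) := by positivity
    dsimp only
    split_ifs <;> linarith
  · rintro a b c hab hbc ⟨h1, h2⟩
    have hab' : (a : ℕ) ≤ b := hab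
    have hbc' : (b : ℕ) < c := hbc
    have ha : (a : ℕ) < k - 1 := by omega
    have hb : (b : ℕ) < k - 1 := by omega
    have := hlt a ha
    have := hlt b hb
    have : (0 : ℝ) ≤ (a : ℕ) := by positivity
    have : (0 : ℝ) ≤ (b : ℕ) := by positivity
    dsimp only at h1 h2
    rw [if_pos ha, if_pos hb] at h1 h2
    split_ifs at h1 h2 with hc
    · have := hlt c hc
      nlinarith
    · linarith
  · intro l hl
    simp [hl]

theorem exists_pairCount_ge {k n : ℕ} (hk : 2 ≤ k) (e : Fin k) (he : (e : ℕ) = k - 1) {δ s T ε : ℝ}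
    (hδ : δ ≤ 1 / 8) (hs : 0 ≤ s) (hε : 0 < ε) (hT : 6 * k + s ≤ T) (hnT : (n : ℝ) ^ 2 ≤ T * ε) :
    ∃ t : Fin k → ℝ, IsAdmissible δ s t ∧ t e = T ∧
      ∃ p : Fin n → EuclideanSpace ℝ (Fin 2), IsSeparated1 p ∧
        (n : ℝ) ^ 2 / 4 + ((k : ℝ) - 1) * n - (6 * (k : ℝ) ^ 2 + 1) ≤ pairCount p t ε := by
  obtain ⟨t, h1, h2, h3⟩ := exists_isAdmissible_gap hk e he hδ hs hT
  have hk' : (2 : ℝ) ≤ k := by exact_mod_cast hk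
  exact ⟨t, h1, h2, exists_separated_two_lines hε t h3 e he h2 (by linarith) hnT⟩

theorem mainTheorem1 :
    -- the upper bound for unit intervals
    (∀ k : ℕ, 2 ≤ k → ∀ δ : ℝ, 0 < δ → δ < 1 →
      ∃ N : ℕ, ∃ C : ℝ, 0 < N ∧ 0 < C ∧
        ∀ n : ℕ, N ≤ n → ∀ t : Fin k → ℝ, IsAdmissible δ 2 t →
          ∀ p : Fin n → EuclideanSpace ℝ (Fin 2), IsSeparated1 p →
            (pairCount p t 1 : ℝ) ≤ (n : ℝ) ^ 2 / 4 + C * n) ∧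
    -- the upper bound for intervals of length `α`
    (∀ k : ℕ, 2 ≤ k → ∀ δ : ℝ, 0 < δ → δ < 1 → ∀ α : ℝ, 0 < α →
      ∃ N : ℕ, ∃ C : ℝ, 0 < N ∧ 0 < C ∧
        ∀ n : ℕ, N ≤ n → ∀ t : Fin k → ℝ, IsAdmissible δ (2 * α) t →
          ∀ p : Fin n → EuclideanSpace ℝ (Fin 2), IsSeparated1 p →
            (pairCount p t α : ℝ) ≤ (n : ℝ) ^ 2 / 4 + C * n) ∧
    -- sharpness, with intervals of length `ε`
    (∃ c : ℝ, 0 < c ∧ ∀ (k : ℕ) (hk : 2 ≤ k),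
      ∃ δ₀ : ℝ, ∃ C : ℝ, 0 < δ₀ ∧ δ₀ < 1 ∧ 0 < C ∧
        ∀ δ : ℝ, 0 < δ → δ ≤ δ₀ → ∀ ε : ℝ, 0 < ε → ∀ n : ℕ,
          -- the hypothesis for unit intervals, with an explicit range of `t_k`
          (∀ T : ℝ, max ((3 : ℝ) ^ (k - 1)) (c * (n : ℝ) ^ 2 / ε) ≤ T →
            ∃ t : Fin k → ℝ, IsAdmissible δ 2 t ∧ t ⟨k - 1, by omega⟩ = T ∧
              ∃ p : Fin n → EuclideanSpace ℝ (Fin 2), IsSeparated1 p ∧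
                (n : ℝ) ^ 2 / 4 + ((k : ℝ) - 1) * n - C ≤ (pairCount p t ε : ℝ)) ∧
          -- the hypothesis for intervals of length `α`, for all sufficiently large `t_k`
          (∀ α : ℝ, 0 < α → ∃ T₀ : ℝ, ∀ T : ℝ, T₀ ≤ T →
            ∃ t : Fin k → ℝ, IsAdmissible δ (2 * α) t ∧ t ⟨k - 1, by omega⟩ = T ∧
              ∃ p : Fin n → EuclideanSpace ℝ (Fin 2), IsSeparated1 p ∧
                (n : ℝ) ^ 2 / 4 + ((k : ℝ) - 1) * n - C ≤ (pairCount p t ε : ℝ))) := by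
  refine ⟨fun k _ δ hδ hδ1 => ?_, fun k _ δ hδ hδ1 α hα => ?_, 1, one_pos, fun k hk => ?_⟩
  · obtain ⟨C, hC, h⟩ := pairCount_le k hδ hδ1 one_pos
    rw [mul_one] at h
    exact ⟨1, C, one_pos, hC, fun n _ => h n⟩
  · obtain ⟨C, hC, h⟩ := pairCount_le k hδ hδ1 hα
    exact ⟨1, C, one_pos, hC, fun n _ => h n⟩
  have hk' : (2 : ℝ) ≤ k := by exact_mod_cast hk
  refine ⟨1 / 8, (((6 * k + 2 : ℕ) : ℝ) + k) ^ 2 + (6 * (k : ℝ) ^ 2 + 1), by norm_num, by norm_num,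
    by positivity, fun δ _ hδ ε hε n => ⟨fun T hT => ?_, fun α hα => ?_⟩⟩
  · have hnT : (n : ℝ) ^ 2 ≤ T * ε := by
      have := (le_max_right _ _).trans hT
      rwa [one_mul, div_le_iff₀ hε] at this
    -- Below this threshold `T` is bounded in terms of `k`, so the loss `(Q + k) ^ 2` of the single
    -- line is an admissible constant.
    rcases le_total (6 * (k : ℝ) + 2) T with hkT | hkT
    · obtain ⟨t, h1, h2, p, h3, h4⟩ :=
        exists_pairCount_ge hk ⟨k - 1, by omega⟩ rfl hδ zero_le_two hε hkT hnT
      exact ⟨t, h1, h2, p, h3, le_trans (by linarith [sq_nonneg (((6 * k + 2 : ℕ) : ℝ) + k)]) h4⟩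
    · have hT3 : 3 ≤ T := by
        refine le_trans ?_ ((le_max_left _ _).trans hT)
        exact le_self_pow₀ (by norm_num) (by omega)
      obtain ⟨t, h1, h2⟩ := exists_isAdmissible_slow hk ⟨k - 1, by omega⟩ rfl hδ hT3 2
      obtain ⟨p, h3, h4⟩ :=
        exists_separated_line (Q := 6 * k + 2) hε (by push_cast; exact hkT) t _ h2
        (by linarith) hnT
      exact ⟨t, h1, h2, p, h3, le_trans (by linarith [sq_nonneg (k : ℝ)]) h4⟩
  · refine ⟨max (6 * k + 2 * α) ((n : ℝ) ^ 2 / ε), fun T hT => ?_⟩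
    have hnT : (n : ℝ) ^ 2 ≤ T * ε := (div_le_iff₀ hε).1 ((le_max_right _ _).trans hT)
    obtain ⟨t, h1, h2, p, h3, h4⟩ :=
        exists_pairCount_ge hk ⟨k - 1, by omega⟩ rfl hδ (by linarith) hε
      ((le_max_left _ _).trans hT) hnT
    exact ⟨t, h1, h2, p, h3, le_trans (by linarith [sq_nonneg (((6 * k + 2 : ℕ) : ℝ) + k)]) h4⟩
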